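/- Let $d\ge 2$ and let $\mathcal K_d$ be the set of $d$-dimensional convex bodies, i.e. compact convex subsets of $\mathbb R^d$ with nonempty interior, equipped with the Hausdorff distance (with respect to the Euclidean norm). An affine invariant point is a map $p:\mathcal K_d\to\mathbb R^d$ which is continuous (for the Hausdorff distance and the Euclidean norm) and satisfies $p(T(C))=T(p(C))$ for every $C\in\mathcal K_d$ and every invertible affine map $T:\mathbb R^d\to\mathbb R^d$. For $C\in\mathcal K_d$ put $$\mathfrak P_d(C)=\{p(C): p \text{ is an affine invariant point}\},$$ $$\mathfrak F_d(C)=\{x\in\mathbb R^d: T(x)=x \text{ for every invertible affine map } T:\mathbb R^d\to\mathbb R^d \text{ with } T(C)=C\}.$$ Then $\mathfrak P_d(C)=\mathfrak F_d(C)$ for every $C\in\mathcal K_d$. -/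

import Mathlib

/-- The set `𝒦_d` of `d`-dimensional convex bodies: convex compact subsets of Euclidean space `ℝ^d`
with nonempty interior. As a subtype of `ConvexBody` it carries the Hausdorff distance with
respect to the Euclidean norm. -/
abbrev FullConvexBody (d : ℕ) : Type :=
  {C : ConvexBody (EuclideanSpace ℝ (Fin d)) //
    (interior (C : Set (EuclideanSpace ℝ (Fin d)))).Nonempty}

/-- The invertible affine maps of `ℝ^d`. -/
abbrev InvertibleAffineMap (d : ℕ) : Type :=
  EuclideanSpace ℝ (Fin d) ≃ᵃ[ℝ] EuclideanSpace ℝ (Fin d)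

/-- The image `T(C)` of a convex body with nonempty interior under an invertible affine map. -/
def FullConvexBody.map {d : ℕ} (T : InvertibleAffineMap d) (C : FullConvexBody d) :
    FullConvexBody d :=
  ⟨{ carrier := T '' (C.1 : Set (EuclideanSpace ℝ (Fin d)))
     convex' := C.1.convex.affine_image T.toAffineMap
     isCompact' := C.1.isCompact.image T.continuous_of_finiteDimensional
     nonempty' := C.1.nonempty.image T },
    by
      have h := (AffineEquiv.toContinuousAffineEquiv T).toHomeomorph.image_interior
        (C.1 : Set (EuclideanSpace ℝ (Fin d)))
      exact (C.2.image (AffineEquiv.toContinuousAffineEquiv T).toHomeomorph).mono h.subset⟩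

/-- Affine invariant points: maps `p : 𝒦_d → ℝ^d`, continuous for the Hausdorff distance and the
Euclidean norm, with `p (T(C)) = T (p C)` for all `C` and all invertible affine `T`. -/
structure IsAffineInvariantPoint {d : ℕ} (p : FullConvexBody d → EuclideanSpace ℝ (Fin d)) :
    Prop where
  continuous : Continuous p
  equivariant : ∀ (C : FullConvexBody d) (T : InvertibleAffineMap d), p (C.map T) = T (p C)

/-- `𝔓_d(C)`: the set of values at `C` of all affine invariant points. -/
def affineInvariantValues {d : ℕ} (C : FullConvexBody d) : Set (EuclideanSpace ℝ (Fin d)) :=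
  {x | ∃ p : FullConvexBody d → EuclideanSpace ℝ (Fin d), IsAffineInvariantPoint p ∧ p C = x}

/-- `𝔉_d(C)`: the set of points fixed by every invertible affine `T` with `T(C) = C`. -/
def affineSymmetryFixedPoints {d : ℕ} (C : FullConvexBody d) :
    Set (EuclideanSpace ℝ (Fin d)) :=
  {x | ∀ T : InvertibleAffineMap d, C.map T = C → T x = x}

open MeasureTheory Filter Topology Set Metric

/-! An affine invariant point commutes with the symmetries of `C`, so its value at `C` is fixed by
them; the substance is the converse. Measuring points from the centroid, itself an affine invariant
point, leaves vectors that ignore translations and transform by the linear part. Let `u = x -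
C.centroid` with `x` fixed by all symmetries of `C`. Average `A u` over the general linear group
against Haar measure, weighting `A` by how nearly `A⁻¹` carries the recentred argument to the
recentred `C`. Left invariance makes the average equivariant (`weightedAverage_map`), and
compactness of the relevant set of `A`, locally uniform in the argument, makes it continuous
(`exists_isCompact_le_dist_recenter`).

At `C` itself, as the tolerance shrinks, the weight concentrates near the symmetries, which fix `u`,
so the normalised averages tend to `u`. The values at `C` of covariant vectors form a subspace of a
finite-dimensional space, hence a closed set, so the limit `u` is attained exactly. -/

/-- If every point of a closed ball is within `δ` of a closed convex set `D`, then the concentric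
closed ball whose radius is smaller by `δ` lies in `D`. -/
theorem Convex.closedBall_subset_of_forall_dist_le {E : Type*} [NormedAddCommGroup E]
    [InnerProductSpace ℝ E] [CompleteSpace E] {D : Set E} (hD : Convex ℝ D) (hc : IsClosed D)
    {x : E} {r δ : ℝ} (hr : 0 ≤ r) (hδ : 0 ≤ δ)
    (h : ∀ y ∈ closedBall x r, ∃ z ∈ D, dist y z ≤ δ) :
    closedBall x (r - δ) ⊆ D := by
  intro y hy
  by_contra hyD
  have hne : D.Nonempty := (h x (mem_closedBall_self hr)).imp fun _ h => h.1
  obtain ⟨p, hp, hmin⟩ := exists_norm_eq_iInf_of_complete_convex hne hc.isComplete hD y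
  rw [norm_eq_iInf_iff_real_inner_le_zero hD hp] at hmin
  have hw : 0 < ‖y - p‖ := norm_pos_iff.2 (sub_ne_zero.2 fun h => hyD (h ▸ hp))
  -- Push `y` outward by `δ` from its projection `p`. The halfspace at `p` with normal `y - p`
  -- contains `D`, so the new point is at distance at least `‖y - p‖ + δ > δ` from `D`, yet it stays
  -- in the larger ball.
  obtain ⟨z, hz, hyz⟩ := h (y + (δ / ‖y - p‖) • (y - p)) (by
    rw [mem_closedBall, dist_eq_norm] at hy ⊢
    calc ‖y + (δ / ‖y - p‖) • (y - p) - x‖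
        = ‖(y - x) + (δ / ‖y - p‖) • (y - p)‖ := by congr 1; abel
      _ ≤ ‖y - x‖ + ‖(δ / ‖y - p‖) • (y - p)‖ := norm_add_le _ _
      _ = ‖y - x‖ + δ := by
          rw [norm_smul, Real.norm_of_nonneg (by positivity), div_mul_cancel₀ _ hw.ne']
      _ ≤ r := by linarith)
  have h1 := real_inner_le_norm (y - p) (y + (δ / ‖y - p‖) • (y - p) - z)
  rw [dist_eq_norm] at hyz
  have h2 : inner ℝ (y - p) (y + (δ / ‖y - p‖) • (y - p) - z)
      = ‖y - p‖ ^ 2 + δ * ‖y - p‖ - inner ℝ (y - p) (z - p) := by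
    have : y + (δ / ‖y - p‖) • (y - p) - z
        = (y - p) + (δ / ‖y - p‖) • (y - p) - (z - p) := by abel
    rw [this, inner_sub_right, inner_add_right, inner_smul_right, real_inner_self_eq_norm_sq]
    field_simp
  nlinarith [hmin z hz, mul_le_mul_of_nonneg_left hyz hw.le]

/-! ### Hausdorff-close bodies: inclusions and inner balls -/

namespace FullConvexBody

variable {d : ℕ}

local notation "𝔼" => EuclideanSpace ℝ (Fin d)

theorem exists_dist_lt {C D : FullConvexBody d} {r : ℝ} (h : dist C D < r) {x : 𝔼}
    (hx : x ∈ C.1) : ∃ y ∈ D.1, dist x y < r :=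
  exists_dist_lt_of_hausdorffDist_lt (s := (C.1 : Set 𝔼)) (t := D.1) hx h
    ConvexBody.hausdorffEDist_ne_top

theorem dist_le_of_forall {C D : FullConvexBody d} {r : ℝ} (hr : 0 ≤ r)
    (h1 : ∀ x ∈ C.1, ∃ y ∈ D.1, dist x y ≤ r) (h2 : ∀ y ∈ D.1, ∃ x ∈ C.1, dist y x ≤ r) :
    dist C D ≤ r :=
  hausdorffDist_le_of_mem_dist (s := (C.1 : Set 𝔼)) (t := D.1) hr h1 h2

theorem ext_coe {C D : FullConvexBody d} (h : (C.1 : Set 𝔼) = D.1) : C = D :=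
  Subtype.ext (ConvexBody.ext h)

theorem coe_map (T : InvertibleAffineMap d) (C : FullConvexBody d) :
    ((C.map T).1 : Set 𝔼) = T '' (C.1 : Set 𝔼) := rfl

theorem closedBall_subset_of_dist_lt {C D : FullConvexBody d} {x : 𝔼} {r δ : ℝ} (hr : 0 ≤ r)
    (h : dist C D < δ) (hC : closedBall x r ⊆ (C.1 : Set 𝔼)) :
    closedBall x (r - δ) ⊆ (D.1 : Set 𝔼) :=
  D.1.convex.closedBall_subset_of_forall_dist_le D.1.isClosed hr (dist_nonneg.trans h.le)
    fun _ hy => (exists_dist_lt h (hC hy)).imp fun _ hz => ⟨hz.1, hz.2.le⟩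

theorem subset_cthickening_of_dist_lt {C D : FullConvexBody d} {δ : ℝ} (h : dist D C < δ) :
    (D.1 : Set 𝔼) ⊆ cthickening δ (C.1 : Set 𝔼) := fun x hx => by
  obtain ⟨y, hy, hxy⟩ := exists_dist_lt h hx
  exact mem_cthickening_of_dist_le x y δ _ hy hxy.le

theorem exists_closedBall_subset (C : FullConvexBody d) :
    ∃ x : 𝔼, ∃ r > 0, closedBall x r ⊆ (C.1 : Set 𝔼) := by
  obtain ⟨x, hx⟩ := C.2
  obtain ⟨r, hr, h⟩ := nhds_basis_closedBall.mem_iff.1 (mem_interior_iff_mem_nhds.1 hx)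
  exact ⟨x, r, hr, h⟩

/-! ### The centroid -/

theorem eventually_mem_iff (C : FullConvexBody d) {x : 𝔼}
    (hx : x ∉ frontier (C.1 : Set 𝔼)) : ∀ᶠ D : FullConvexBody d in 𝓝 C, (x ∈ D.1 ↔ x ∈ C.1) := by
  by_cases hxC : x ∈ C.1
  · have hint : x ∈ interior (C.1 : Set 𝔼) := by
      by_contra hi
      exact hx (by rw [C.1.isClosed.frontier_eq]; exact ⟨hxC, hi⟩)
    obtain ⟨r, hr, h⟩ := nhds_basis_closedBall.mem_iff.1 (mem_interior_iff_mem_nhds.1 hint)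
    filter_upwards [ball_mem_nhds C hr] with D hD
    refine iff_of_true (closedBall_subset_of_dist_lt hr.le (mem_ball'.1 hD) h ?_) hxC
    simp
  · obtain ⟨r, hr, h⟩ := Metric.isOpen_iff.1 C.1.isClosed.isOpen_compl x hxC
    filter_upwards [ball_mem_nhds C hr] with D hD
    refine iff_of_false (fun hxD => ?_) hxC
    obtain ⟨y, hy, hxy⟩ := exists_dist_lt (mem_ball.1 hD) hxD
    exact h (mem_ball'.2 hxy) hy

/-- Dominated convergence: indicators converge off the frontier, which is null by convexity, and
nearby bodies lie in a compact thickening of `C`. -/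
theorem continuous_setIntegral {F : Type*} [NormedAddCommGroup F] [NormedSpace ℝ F]
    {f : 𝔼 → F} (hf : Continuous f) :
    Continuous fun C : FullConvexBody d => ∫ x in (C.1 : Set 𝔼), f x := by
  refine continuous_iff_continuousAt.2 fun C => ?_
  have hmeas (D : FullConvexBody d) : MeasurableSet (D.1 : Set 𝔼) := D.1.isClosed.measurableSet
  have hK : IsCompact (cthickening 1 (C.1 : Set 𝔼)) := C.1.isCompact.cthickening
  simp only [ContinuousAt, ← integral_indicator (hmeas _)]
  refine tendsto_integral_filter_of_dominated_convergence
    ((cthickening 1 (C.1 : Set 𝔼)).indicator fun x => ‖f x‖) ?_ ?_ ?_ ?_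
  · exact .of_forall fun D =>
      (hf.aestronglyMeasurable).indicator (hmeas D)
  · filter_upwards [ball_mem_nhds C one_pos] with D hD
    refine .of_forall fun x => ?_
    rw [norm_indicator_eq_indicator_norm]
    exact indicator_le_indicator_of_subset (subset_cthickening_of_dist_lt hD)
      (fun _ => norm_nonneg _) x
  · rw [integrable_indicator_iff isClosed_cthickening.measurableSet]
    exact hf.norm.continuousOn.integrableOn_compact hK
  · have h0 : (volume : Measure 𝔼) (frontier (C.1 : Set 𝔼)) = 0 :=
      C.1.convex.addHaar_frontier volume
    filter_upwards [measure_eq_zero_iff_ae_notMem.1 h0] with x hx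
    refine tendsto_const_nhds.congr' ?_
    filter_upwards [C.eventually_mem_iff hx] with D hD
    by_cases hxC : x ∈ (C.1 : Set 𝔼)
    · rw [indicator_of_mem hxC, indicator_of_mem (hD.2 hxC)]
    · rw [indicator_of_notMem hxC, indicator_of_notMem fun h => hxC (hD.1 h)]

theorem volume_real_pos (C : FullConvexBody d) : 0 < volume.real (C.1 : Set 𝔼) :=
  ENNReal.toReal_pos (Measure.measure_pos_of_nonempty_interior _ C.2).ne'
    C.1.isCompact.measure_lt_top.ne

theorem continuous_volume_real :
    Continuous fun C : FullConvexBody d => volume.real (C.1 : Set 𝔼) := by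
  simpa using continuous_setIntegral (d := d) (f := fun _ => (1 : ℝ)) continuous_const

/-- The centroid of a convex body. -/
noncomputable def centroid (C : FullConvexBody d) : 𝔼 :=
  (volume.real (C.1 : Set 𝔼))⁻¹ • ∫ x in (C.1 : Set 𝔼), x

theorem setIntegral_map {F : Type*} [NormedAddCommGroup F] [NormedSpace ℝ F]
    (f : 𝔼 → F) (C : FullConvexBody d) (T : InvertibleAffineMap d) :
    ∫ x in ((C.map T).1 : Set 𝔼), f x
      = |(T.linear : 𝔼 →ₗ[ℝ] 𝔼).det| • ∫ x in (C.1 : Set 𝔼), f (T x) := by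
  have hT (x : 𝔼) : HasFDerivAt T (T.linear.toContinuousLinearEquiv : 𝔼 →L[ℝ] 𝔼) x := by
    have h : (T : 𝔼 → 𝔼) = fun x => (T.linear.toContinuousLinearEquiv : 𝔼 →L[ℝ] 𝔼) x + T 0 := by
      funext x
      simpa using T.map_vadd 0 x
    rw [h]
    exact (ContinuousLinearMap.hasFDerivAt _).add_const _
  rw [coe_map, integral_image_eq_integral_abs_det_fderiv_smul volume
    C.1.isClosed.measurableSet (fun x _ => (hT x).hasFDerivWithinAt) T.injective.injOn,
    integral_smul]
  rfl

theorem centroid_map (C : FullConvexBody d) (T : InvertibleAffineMap d) :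
    (C.map T).centroid = T C.centroid := by
  have hdet : |(T.linear : 𝔼 →ₗ[ℝ] 𝔼).det| ≠ 0 :=
    abs_ne_zero.2 (LinearEquiv.isUnit_det' T.linear).ne_zero
  have hvol : volume.real ((C.map T).1 : Set 𝔼)
      = |(T.linear : 𝔼 →ₗ[ℝ] 𝔼).det| * volume.real (C.1 : Set 𝔼) := by
    simpa using setIntegral_map (fun _ => (1 : ℝ)) C T
  have hT (x : 𝔼) : T x = (T.linear.toContinuousLinearEquiv : 𝔼 →L[ℝ] 𝔼) x + T 0 := by
    simpa using T.map_vadd 0 x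
  have hint : Integrable (fun x : 𝔼 => x) (volume.restrict (C.1 : Set 𝔼)) :=
    continuous_id.continuousOn.integrableOn_compact C.1.isCompact
  have hfin : IsFiniteMeasure (volume.restrict (C.1 : Set 𝔼)) :=
    ⟨by simpa using C.1.isCompact.measure_lt_top⟩
  rw [hT C.centroid, centroid, centroid, setIntegral_map, hvol, smul_smul, mul_inv, mul_right_comm,
    inv_mul_cancel₀ hdet, one_mul, map_smul, ← ContinuousLinearMap.integral_comp_comm _ hint]
  rw [integral_congr_ae (.of_forall hT), integral_add (ContinuousLinearMap.integrable_comp _ hint) (integrable_const _), smul_add]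
  simp only [integral_const, measureReal_restrict_apply_univ, smul_smul]
  rw [inv_mul_cancel₀ C.volume_real_pos.ne', one_smul]

theorem continuous_centroid : Continuous (centroid : FullConvexBody d → 𝔼) :=
  (continuous_volume_real.inv₀ fun C => C.volume_real_pos.ne').smul
    (continuous_setIntegral continuous_id)

/-! ### Continuity of the action of affine maps -/

/-- Joint continuity makes `T x` uniformly close to `T a` on a compact thickening of `C a`, which
contains all nearby bodies `C x`. -/
theorem continuous_map {X : Type*} [TopologicalSpace X] {C : X → FullConvexBody d}
    {T : X → InvertibleAffineMap d} (hC : Continuous C)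
    (hT : Continuous fun q : X × 𝔼 => T q.1 q.2) : Continuous fun x => (C x).map (T x) := by
  refine continuous_iff_continuousAt.2 fun a => Metric.tendsto_nhds.2 fun η hη => ?_
  have hK : IsCompact (cthickening 1 ((C a).1 : Set 𝔼)) := (C a).1.isCompact.cthickening
  have hu : ∀ᶠ x in 𝓝 a, ∀ y ∈ cthickening 1 ((C a).1 : Set 𝔼),
      dist (T x y) (T a y) < η / 4 := by
    refine hK.eventually_forall_of_forall_eventually fun y _ => ?_
    have : Continuous fun q : X × 𝔼 => dist (T q.1 q.2) (T a q.2) :=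
      hT.dist (hT.comp (continuous_const.prodMk continuous_snd))
    refine this.tendsto (a, y) |>.eventually_lt_const ?_
    simp [hη]
  have hTa : UniformContinuousOn (T a) (cthickening 1 ((C a).1 : Set 𝔼)) :=
    hK.uniformContinuousOn_of_continuous
      (hT.comp (continuous_const.prodMk continuous_id)).continuousOn
  obtain ⟨δ, hδ, hu'⟩ := Metric.uniformContinuousOn_iff.1 hTa (η / 4) (by positivity)
  have hCa := hC.tendsto a (ball_mem_nhds _ (lt_min one_pos hδ))
  filter_upwards [hu, hCa] with x hx hxC
  have hxC : dist (C x) (C a) < min 1 δ := hxC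
  have hsub := subset_cthickening_of_dist_lt (hxC.trans_le (min_le_left _ _))
  have hself := self_subset_cthickening (δ := 1) ((C a).1 : Set 𝔼)
  have key : ∀ y ∈ (C x).1, ∀ z ∈ (C a).1, dist y z < δ → dist (T x y) (T a z) ≤ η / 2 := by
    intro y hy z hz hyz
    linarith [hx y (hsub hy), hu' y (hsub hy) z (hself hz) hyz,
      dist_triangle (T x y) (T a y) (T a z)]
  refine (dist_le_of_forall (r := η / 2) (by positivity) ?_ ?_).trans_lt (by linarith)
  · rintro _ ⟨y, hy, rfl⟩
    obtain ⟨z, hz, hyz⟩ := exists_dist_lt hxC hy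
    exact ⟨T a z, ⟨z, hz, rfl⟩, key y hy z hz (hyz.trans_le (min_le_right _ _))⟩
  · rintro _ ⟨z, hz, rfl⟩
    rw [dist_comm] at hxC
    obtain ⟨y, hy, hyz⟩ := exists_dist_lt hxC hz
    rw [dist_comm] at hyz
    refine ⟨T x y, ⟨y, hy, rfl⟩, ?_⟩
    rw [dist_comm]
    exact key y hy z hz (hyz.trans_le (min_le_right _ _))

/-- The linear part of an affine map sending a body containing a ball of radius `r` into a ball
of radius `R` has norm at most `2 * R / r`. -/
theorem norm_linear_le {C : FullConvexBody d} {T : InvertibleAffineMap d} {a b : 𝔼} {r R : ℝ}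
    (hr : 0 < r) (ha : closedBall a r ⊆ (C.1 : Set 𝔼))
    (hb : ((C.map T).1 : Set 𝔼) ⊆ closedBall b R) (z : 𝔼) :
    ‖T.linear z‖ ≤ 2 * R / r * ‖z‖ := by
  rcases eq_or_ne z 0 with rfl | hz
  · simp
  have hz' : 0 < ‖z‖ := norm_pos_iff.2 hz
  have hmem (w : 𝔼) (hw : w ∈ closedBall a r) : T w ∈ closedBall b R := hb ⟨w, ha hw, rfl⟩
  have h1 := hmem (a + (r / ‖z‖) • z) (by
    rw [mem_closedBall, dist_eq_norm, add_sub_cancel_left, norm_smul,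
      Real.norm_of_nonneg (by positivity), div_mul_cancel₀ _ hz'.ne'])
  have h2 := hmem a (mem_closedBall_self hr.le)
  have h3 : T (a + (r / ‖z‖) • z) - T a = (r / ‖z‖) • T.linear z := by
    rw [add_comm, ← vadd_eq_add, T.map_vadd, vadd_eq_add, add_sub_cancel_right, map_smul]
  have h4 : ‖(r / ‖z‖) • T.linear z‖ ≤ 2 * R := by
    rw [← h3, ← dist_eq_norm]
    linarith [dist_triangle_right (T (a + (r / ‖z‖) • z)) (T a) b, mem_closedBall.1 h1,
      mem_closedBall.1 h2]
  rw [norm_smul, Real.norm_of_nonneg (by positivity), div_mul_eq_mul_div, div_le_iff₀ hz'] at h4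
  rw [div_mul_eq_mul_div, le_div_iff₀ hr]
  linarith

end FullConvexBody

/-! ### Borel structure and compact sets in the group of units -/

instance Units.borelSpace_of_normedRing {R : Type*} [NormedRing R] [HasSummableGeomSeries R]
    [MeasurableSpace R] [BorelSpace R] : BorelSpace Rˣ where
  measurable_eq := by
    rw [Units.isOpenEmbedding_val.eq_induced, borel_comap, ← BorelSpace.measurable_eq (α := R)]
    rfl

/-- The map `A ↦ (A, A⁻¹)` is a closed embedding, so bounding both components suffices in a proper
ring. -/
theorem Units.isCompact_setOf_norm_le {R : Type*} [NormedRing R] [ProperSpace R] (a b : ℝ) :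
    IsCompact {A : Rˣ | ‖(A : R)‖ ≤ a ∧ ‖((A⁻¹ : Rˣ) : R)‖ ≤ b} := by
  have h : IsCompact (closedBall (0 : R) a ×ˢ (MulOpposite.unop ⁻¹' closedBall (0 : R) b)) :=
    (isCompact_closedBall _ _).prod
      (MulOpposite.opHomeomorph.symm.isClosedEmbedding.isCompact_preimage (isCompact_closedBall _ _))
  convert Units.isClosedEmbedding_embedProduct.isCompact_preimage h using 1
  ext A
  simp [Units.embedProduct]

/-! ### Recentred bodies and properness of the linear action -/

namespace FullConvexBody

variable {d : ℕ}

local notation "𝔼" => EuclideanSpace ℝ (Fin d)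
local notation "𝔾" => (EuclideanSpace ℝ (Fin d) →L[ℝ] EuclideanSpace ℝ (Fin d))ˣ

/-- The affine map `x ↦ A⁻¹ (x - c)`. -/
noncomputable def recenterMap (A : 𝔾) (c : 𝔼) : InvertibleAffineMap d :=
  (AffineEquiv.constVAdd ℝ 𝔼 (-c)).trans
    (ContinuousLinearEquiv.unitsEquiv ℝ 𝔼 A⁻¹).toLinearEquiv.toAffineEquiv

theorem recenterMap_apply (A : 𝔾) (c x : 𝔼) :
    recenterMap A c x = ((A⁻¹ : 𝔾) : 𝔼 →L[ℝ] 𝔼) (x - c) := by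
  rw [sub_eq_neg_add]
  rfl

theorem recenterMap_linear_apply (A : 𝔾) (c x : 𝔼) :
    (recenterMap A c).linear x = ((A⁻¹ : 𝔾) : 𝔼 →L[ℝ] 𝔼) x := rfl

theorem recenterMap_linear_symm_apply (A : 𝔾) (c x : 𝔼) :
    (recenterMap A c).symm.linear x = (A : 𝔼 →L[ℝ] 𝔼) x := by
  change (recenterMap A c).linear.symm x = _
  rw [LinearEquiv.symm_apply_eq, recenterMap_linear_apply, ← mul_apply_eq_comp,
    Units.inv_mul, one_apply_eq_self]

/-- The body `A⁻¹ (C - centroid C)`. -/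
noncomputable def recenter (A : 𝔾) (C : FullConvexBody d) : FullConvexBody d :=
  C.map (recenterMap A C.centroid)

theorem continuous_recenter :
    Continuous fun q : FullConvexBody d × 𝔾 => recenter q.2 q.1 := by
  refine continuous_map continuous_fst ?_
  simp only [recenterMap_apply]
  have h : Continuous fun q : (FullConvexBody d × 𝔾) × 𝔼 =>
      (((q.1.2)⁻¹ : 𝔾) : 𝔼 →L[ℝ] 𝔼) :=
    Units.continuous_val.comp (continuous_snd.comp continuous_fst).inv
  exact h.clm_apply
    (continuous_snd.sub (continuous_centroid.comp (continuous_fst.comp continuous_fst)))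

theorem map_map (C : FullConvexBody d) (S T : InvertibleAffineMap d) :
    (C.map S).map T = C.map (S.trans T) :=
  ext_coe (by rw [coe_map, coe_map, coe_map, image_image]; rfl)

theorem map_symm_map (C : FullConvexBody d) (T : InvertibleAffineMap d) :
    (C.map T).map T.symm = C :=
  ext_coe (by rw [coe_map, coe_map, image_image]; simp)

/-- The linear part of an invertible affine map, as a unit. -/
noncomputable def linearUnit (T : InvertibleAffineMap d) : 𝔾 :=
  ContinuousLinearEquiv.toUnit T.linear.toContinuousLinearEquiv

/-- Transforming the body amounts to a left translation of `A`, which Haar measure does not see. -/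
theorem recenter_map (A : 𝔾) (C : FullConvexBody d) (T : InvertibleAffineMap d) :
    recenter A (C.map T) = recenter ((linearUnit T)⁻¹ * A) C := by
  rw [recenter, recenter, map_map]
  congr 1
  ext1 x
  have h : T x - T C.centroid = (linearUnit T : 𝔼 →L[ℝ] 𝔼) (x - C.centroid) :=
    (T.toAffineMap.linearMap_vsub x C.centroid).symm
  rw [AffineEquiv.trans_apply, recenterMap_apply, recenterMap_apply, centroid_map, h, mul_inv_rev,
    inv_inv, Units.val_mul, mul_apply_eq_comp]

theorem subset_closedBall_of_dist_lt {C D : FullConvexBody d} {b : 𝔼} {R δ : ℝ}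
    (h : dist D C < δ) (hC : (C.1 : Set 𝔼) ⊆ closedBall b R) :
    (D.1 : Set 𝔼) ⊆ closedBall b (R + δ) := fun x hx => by
  obtain ⟨y, hy, hxy⟩ := exists_dist_lt h hx
  rw [mem_closedBall]
  linarith [dist_triangle x y b, mem_closedBall.1 (hC hy)]

/-- Locally in `C`, the linear maps `A` for which `A⁻¹ (C - centroid C)` is close to a given body
lie in a compact set. -/
theorem exists_isCompact_le_dist_recenter (D : FullConvexBody d) :
    ∃ ε > 0, ∀ C, ∃ K : Set 𝔾, IsCompact K ∧
      ∀ᶠ C' in 𝓝 C, ∀ A ∉ K, ε ≤ dist (recenter A C') D := by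
  obtain ⟨a, r, hr, ha⟩ := D.exists_closedBall_subset
  obtain ⟨R, hR, hb⟩ := D.1.isCompact.isBounded.subset_closedBall_lt 0 0
  -- Half the inner radius of `D` serves every `C`: a body closer to `D` than this still contains a
  -- ball of radius `r / 2` and lies in one of radius `R + r / 2`.
  refine ⟨r / 2, by positivity, fun C => ?_⟩
  obtain ⟨a', r', hr', ha'⟩ := C.exists_closedBall_subset
  obtain ⟨R', hR', hb'⟩ := C.1.isCompact.isBounded.subset_closedBall_lt 0 0
  refine ⟨_, Units.isCompact_setOf_norm_le (2 * (R' + r' / 2) / (r - r / 2))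
    (2 * (R + r / 2) / (r' - r' / 2)), ?_⟩
  have hr2 : 0 < r - r / 2 := by linarith
  have hr2' : 0 < r' - r' / 2 := by linarith
  filter_upwards [ball_mem_nhds C (half_pos hr')] with C' hC' A hA
  by_contra! hlt
  have hC₁ := closedBall_subset_of_dist_lt hr'.le (mem_ball'.1 hC') ha'
  have hC₂ := subset_closedBall_of_dist_lt (mem_ball.1 hC') hb'
  have hD₂ := subset_closedBall_of_dist_lt hlt hb
  rw [dist_comm] at hlt
  have hD₁ := closedBall_subset_of_dist_lt hr.le hlt ha
  refine hA ⟨ContinuousLinearMap.opNorm_le_bound _ (by positivity) fun z => ?_,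
    ContinuousLinearMap.opNorm_le_bound _ (by positivity) fun z => ?_⟩
  -- `A` is the linear part of the map from the recentred body back to `C'`, and `A⁻¹` that of the
  -- map forward; each is bounded by an inner radius of its source and an outer radius of its
  -- target.
  · rw [← recenterMap_linear_symm_apply A C'.centroid]
    refine norm_linear_le (b := 0) hr2 hD₁ ?_ z
    rw [recenter, map_symm_map]
    exact hC₂
  · exact norm_linear_le hr2' hC₁ hD₂ z

/-! ### Covariant vectors and Haar averages -/

/-- Continuous vector-valued functions of convex bodies that are invariant under translations and
equivariant under linear maps. -/
structure IsCovariantVector (v : FullConvexBody d → 𝔼) : Prop where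
  continuous : Continuous v
  map : ∀ (C : FullConvexBody d) (T : InvertibleAffineMap d), v (C.map T) = T.linear (v C)

theorem IsCovariantVector.isAffineInvariantPoint {v : FullConvexBody d → 𝔼}
    (hv : IsCovariantVector v) : IsAffineInvariantPoint fun C => v C + C.centroid where
  continuous := hv.continuous.add continuous_centroid
  equivariant C T := by
    rw [hv.map, centroid_map, ← vadd_eq_add, ← T.map_vadd, vadd_eq_add]

/-- The values at `C` of covariant vectors, as a subspace. -/
def covariantValues (C : FullConvexBody d) : Submodule ℝ 𝔼 where
  carrier := {x | ∃ v, IsCovariantVector v ∧ v C = x}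
  zero_mem' := ⟨fun _ => 0, ⟨continuous_const, fun _ _ => (map_zero _).symm⟩, rfl⟩
  add_mem' := by
    rintro _ _ ⟨v, hv, rfl⟩ ⟨w, hw, rfl⟩
    exact ⟨fun D => v D + w D, ⟨hv.continuous.add hw.continuous, fun D T => by
      rw [hv.map, hw.map, map_add]⟩, rfl⟩
  smul_mem' := by
    rintro c _ ⟨v, hv, rfl⟩
    exact ⟨fun D => c • v D, ⟨hv.continuous.const_smul c, fun D T => by
      rw [hv.map, map_smul]⟩, rfl⟩

theorem IsCovariantVector.mem_covariantValues {v : FullConvexBody d → 𝔼}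
    (hv : IsCovariantVector v) (C : FullConvexBody d) : v C ∈ covariantValues C :=
  ⟨v, hv, rfl⟩

/-- A weight that vanishes unless `A⁻¹ (C - centroid C)` is `ε`-close to `D`. -/
noncomputable def weight (ε : ℝ) (D C : FullConvexBody d) (A : 𝔾) : ℝ :=
  max 0 (ε - dist (recenter A C) D)

theorem weight_nonneg (ε : ℝ) (D C : FullConvexBody d) (A : 𝔾) : 0 ≤ weight ε D C A :=
  le_max_left _ _

theorem weight_eq_zero {ε : ℝ} {D C : FullConvexBody d} {A : 𝔾} (h : ε ≤ dist (recenter A C) D) :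
    weight ε D C A = 0 := max_eq_left (sub_nonpos.2 h)

theorem continuous_weight (ε : ℝ) (D : FullConvexBody d) :
    Continuous fun q : FullConvexBody d × 𝔾 => weight ε D q.1 q.2 :=
  continuous_const.max (continuous_const.sub (continuous_recenter.dist continuous_const))

theorem continuous_weight_right (ε : ℝ) (D C : FullConvexBody d) : Continuous (weight ε D C) :=
  continuous_const.max (continuous_const.sub
    ((continuous_recenter.comp (Continuous.prodMk_right C)).dist continuous_const))

/-- The average of the vectors `A u` over the linear group, with weight concentrated at those `A`
for which `A⁻¹ (C - centroid C)` is `ε`-close to `D`. -/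
noncomputable def weightedAverage (ε : ℝ) (D : FullConvexBody d) (u : 𝔼) (C : FullConvexBody d) :
    𝔼 :=
  ∫ A : 𝔾, weight ε D C A • (A : 𝔼 →L[ℝ] 𝔼) u ∂Measure.haar

theorem weightedAverage_map (ε : ℝ) (D : FullConvexBody d) (u : 𝔼) (C : FullConvexBody d)
    (T : InvertibleAffineMap d) :
    weightedAverage ε D u (C.map T) = T.linear (weightedAverage ε D u C) := by
  change _ = T.linear.toContinuousLinearEquiv (weightedAverage ε D u C)
  -- Substitute `linearUnit T * A` for `A`: the weight returns to that of `C`, and the linear part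
  -- of `T` factors out of the vector.
  rw [weightedAverage, weightedAverage, ← ContinuousLinearEquiv.integral_comp_comm,
    ← integral_mul_left_eq_self _ (linearUnit T)]
  refine integral_congr_ae (.of_forall fun A => ?_)
  simp only [weight, recenter_map, inv_mul_cancel_left, map_smul]
  rfl

theorem isCovariantVector_weightedAverage {D : FullConvexBody d} {ε : ℝ}
    (h : ∀ C, ∃ K : Set 𝔾, IsCompact K ∧ ∀ᶠ C' in 𝓝 C, ∀ A ∉ K, ε ≤ dist (recenter A C') D)
    (u : 𝔼) : IsCovariantVector (weightedAverage ε D u) where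
  continuous := continuous_iff_continuousAt.2 fun C => by
    obtain ⟨K, hK, hC⟩ := h C
    refine (continuousOn_integral_of_compact_support hK (Continuous.continuousOn ?_)
      fun C' A hC' hA => ?_).continuousAt hC
    · exact (continuous_weight ε D).smul
        ((Units.continuous_val.comp continuous_snd).clm_apply continuous_const)
    · rw [weight_eq_zero (hC' A hA), zero_smul]
  map C T := weightedAverage_map ε D u C T

/-! ### Concentration of the averages near the symmetry group -/

/-- If `A⁻¹ (C - centroid C) = C - centroid C`, then `A` fixes every point fixed by the affine
symmetries of `C`, relative to the centroid. -/
theorem apply_sub_centroid_of_recenter_eq {C : FullConvexBody d} {x : 𝔼}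
    (hx : x ∈ affineSymmetryFixedPoints C) {A : 𝔾} (h : recenter A C = recenter 1 C) :
    (A : 𝔼 →L[ℝ] 𝔼) (x - C.centroid) = x - C.centroid := by
  -- The composite `y ↦ A⁻¹ (y - c) + c`, with `c` the centroid, is a symmetry of `C`.
  have hT := hx ((recenterMap A C.centroid).trans (recenterMap 1 C.centroid).symm) (by
    rw [← map_map]
    change (recenter A C).map _ = C
    rw [h, recenter, map_symm_map])
  rw [AffineEquiv.trans_apply, AffineEquiv.symm_apply_eq, recenterMap_apply, recenterMap_apply,
    inv_one, Units.val_one, one_apply_eq_self] at hT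
  nth_rw 1 [← hT]
  rw [← mul_apply_eq_comp, Units.mul_inv, one_apply_eq_self]

theorem continuous_unit_apply (u : 𝔼) : Continuous fun A : 𝔾 => (A : 𝔼 →L[ℝ] 𝔼) u :=
  Units.continuous_val.clm_apply continuous_const

/-- Linear maps that nearly preserve `C - centroid C` nearly fix the points fixed by the affine
symmetries of `C`, relative to the centroid. -/
theorem exists_forall_norm_apply_sub_le {C : FullConvexBody d} {x : 𝔼}
    (hx : x ∈ affineSymmetryFixedPoints C) {ε₀ η : ℝ} (hε₀ : 0 < ε₀) (hη : 0 < η)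
    {K : Set 𝔾} (hK : IsCompact K)
    (hKC : ∀ A ∉ K, ε₀ ≤ dist (recenter A C) (recenter 1 C)) :
    ∃ ε > 0, ε ≤ ε₀ ∧ ∀ A : 𝔾, dist (recenter A C) (recenter 1 C) < ε →
      ‖(A : 𝔼 →L[ℝ] 𝔼) (x - C.centroid) - (x - C.centroid)‖ ≤ η := by
  have hcr : Continuous fun A : 𝔾 => dist (recenter A C) (recenter 1 C) :=
    (continuous_recenter.comp (Continuous.prodMk_right C)).dist continuous_const
  have hS : IsCompact
      (K ∩ {A : 𝔾 | η ≤ ‖(A : 𝔼 →L[ℝ] 𝔼) (x - C.centroid) - (x - C.centroid)‖}) :=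
    hK.inter_right (isClosed_le continuous_const
      ((continuous_unit_apply _).sub continuous_const).norm)
  rcases Set.eq_empty_or_nonempty
    (K ∩ {A : 𝔾 | η ≤ ‖(A : 𝔼 →L[ℝ] 𝔼) (x - C.centroid) - (x - C.centroid)‖}) with hemp | hne
  · refine ⟨ε₀, hε₀, le_rfl, fun A hA => ?_⟩
    by_contra! hfar
    exact hemp.subset ⟨not_imp_comm.1 (hKC A) hA.not_ge, hfar.le⟩
  · obtain ⟨B, hB, hmin⟩ := hS.exists_isMinOn hne hcr.continuousOn
    -- `B` minimises the distance among the maps in `K` moving the vector by at least `η`. The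
    -- minimum is positive, since at distance zero `B` would come from a symmetry and fix the
    -- vector.
    refine ⟨min ε₀ (dist (recenter B C) (recenter 1 C)),
      lt_min hε₀ (dist_pos.2 fun h => ?_), min_le_left _ _, fun A hA => ?_⟩
    · have := hB.2
      rw [mem_ofPred_eq, apply_sub_centroid_of_recenter_eq hx h, sub_self, norm_zero] at this
      linarith
    · by_contra! hfar
      have hAK := not_imp_comm.1 (hKC A) (hA.trans_le (min_le_left _ _)).not_ge
      exact (hA.trans_le (min_le_right _ _)).not_ge (hmin ⟨hAK, hfar.le⟩)

theorem norm_integral_smul_apply_sub_le {w : 𝔾 → ℝ} (hw : Continuous w)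
    (hsupp : HasCompactSupport w) (hnn : ∀ A, 0 ≤ w A) {u : 𝔼} {η : ℝ}
    (h : ∀ A : 𝔾, w A ≠ 0 → ‖(A : 𝔼 →L[ℝ] 𝔼) u - u‖ ≤ η) (μ : Measure 𝔾)
    [IsFiniteMeasureOnCompacts μ] :
    ‖∫ A : 𝔾, w A • (A : 𝔼 →L[ℝ] 𝔼) u ∂μ - (∫ A, w A ∂μ) • u‖ ≤ (∫ A, w A ∂μ) * η := by
  have hint₁ : Integrable (fun A : 𝔾 => w A • (A : 𝔼 →L[ℝ] 𝔼) u) μ :=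
    (hw.smul (continuous_unit_apply u)).integrable_of_hasCompactSupport hsupp.smul_right
  have hint₂ : Integrable w μ := hw.integrable_of_hasCompactSupport hsupp
  rw [← integral_smul_const, ← integral_sub hint₁ (hint₂.smul_const u), ← integral_mul_const]
  refine norm_integral_le_of_norm_le (hint₂.mul_const _) (.of_forall fun A => ?_)
  rw [← smul_sub, norm_smul, Real.norm_of_nonneg (hnn A)]
  by_cases hA : w A = 0
  · rw [hA, zero_mul, zero_mul]
  · exact mul_le_mul_of_nonneg_left (h A hA) (hnn A)

theorem dist_inv_smul_lt {E : Type*} [NormedAddCommGroup E] [NormedSpace ℝ E] {c η : ℝ} {u y : E}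
    (hc : 0 < c) (hη : 0 < η) (h : ‖y - c • u‖ ≤ c * (η / 2)) : dist u (c⁻¹ • y) < η := by
  calc dist u (c⁻¹ • y) = ‖c⁻¹ • (y - c • u)‖ := by
        rw [dist_eq_norm', smul_sub, inv_smul_smul₀ hc.ne']
    _ = c⁻¹ * ‖y - c • u‖ := by rw [norm_smul, Real.norm_of_nonneg (inv_nonneg.2 hc.le)]
    _ ≤ c⁻¹ * (c * (η / 2)) := mul_le_mul_of_nonneg_left h (inv_nonneg.2 hc.le)
    _ < η := by rw [inv_mul_cancel_left₀ hc.ne']; linarith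

theorem sub_centroid_mem_covariantValues {C : FullConvexBody d} {x : 𝔼}
    (hx : x ∈ affineSymmetryFixedPoints C) : x - C.centroid ∈ covariantValues C := by
  obtain ⟨ε₀, hε₀, hprop⟩ := exists_isCompact_le_dist_recenter (recenter 1 C)
  -- A finite-dimensional subspace is closed, so approximation within every `η` is enough.
  rw [← SetLike.mem_coe, ← (Submodule.closed_of_finiteDimensional (covariantValues C)).closure_eq,
    Metric.mem_closure_iff]
  intro η hη
  obtain ⟨K, hK, hKC⟩ := hprop C
  replace hKC := hKC.self_of_nhds
  obtain ⟨ε, hε, hεε₀, hclose⟩ := exists_forall_norm_apply_sub_le hx hε₀ (half_pos hη) hK hKC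
  have hcov : IsCovariantVector (weightedAverage ε (recenter 1 C) (x - C.centroid)) :=
    isCovariantVector_weightedAverage (fun C' => by
      obtain ⟨K', hK', h⟩ := hprop C'
      exact ⟨K', hK', h.mono fun _ h A hA => hεε₀.trans (h A hA)⟩) _
  have hcw : Continuous (weight ε (recenter 1 C) C) := continuous_weight_right ε _ C
  have hsupp : HasCompactSupport (weight ε (recenter 1 C) C) :=
    HasCompactSupport.intro hK fun A hA => weight_eq_zero (hεε₀.trans (hKC A hA))
  -- At `A = 1` the weight equals `ε`, so the normalising constant is positive.
  have hpos : 0 < ∫ A, weight ε (recenter 1 C) C A ∂Measure.haar :=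
    hcw.integral_pos_of_hasCompactSupport_nonneg_nonzero hsupp (weight_nonneg ε _ C) (x := 1)
      (by rw [weight, dist_self, sub_zero, max_eq_right hε.le]; exact hε.ne')
  have hnorm := norm_integral_smul_apply_sub_le hcw hsupp (weight_nonneg ε _ C)
    (fun A hA => hclose A (not_le.1 fun h => hA (weight_eq_zero h))) Measure.haar
  change ‖weightedAverage ε (recenter 1 C) (x - C.centroid) C - _‖ ≤ _ at hnorm
  refine ⟨_ • weightedAverage ε (recenter 1 C) (x - C.centroid) C,
    Submodule.smul_mem _ _ (hcov.mem_covariantValues C), dist_inv_smul_lt hpos hη hnorm⟩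

end FullConvexBody

theorem theorem1p1 (d : ℕ) (hd : 2 ≤ d) (C : FullConvexBody d) :
    affineInvariantValues C = affineSymmetryFixedPoints C := by
  refine Subset.antisymm ?_ fun x hx => ?_
  · rintro _ ⟨p, hp, rfl⟩ T hT
    rw [← hp.equivariant, hT]
  · obtain ⟨v, hv, hvC⟩ := FullConvexBody.sub_centroid_mem_covariantValues hx
    exact ⟨_, hv.isAffineInvariantPoint, by rw [hvC, sub_add_cancel]⟩
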